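/- Let $\Omega\subset\mathbb{R}$ be a bounded open set and let $\mathcal{E}=L^2(\Omega)\times L^2(\Omega)$ be the real Hilbert space with inner product $\langle (u_1,v_1),(u_2,v_2)\rangle_{\mathcal E}=\int_\Omega u_1u_2+\int_\Omega v_1v_2$. Let $\mathcal{A}:\mathcal{D}(\mathcal{A})\subset\mathcal{E}\to\mathcal{E}$ be the operator $\mathcal{A}(u,v)=(u_{xx},v_{xx})$ (weak derivatives) with domain $\mathcal{D}(\mathcal{A})=\big(H^2(\Omega)\cap H^1_0(\Omega)\big)\times\big(H^2(\Omega)\cap H^1_0(\Omega)\big)$. Then $\mathcal{A}$ generates a $C_0$-semigroup of contractions $T(t)=e^{t\mathcal A}$ on $\mathcal{E}$. That is, there is a family $(T(t))_{t\ge 0}$ of bounded linear operators on $\mathcal{E}$ with $T(0)=I$, $T(s+t)=T(s)T(t)$ for all $s,t\ge0$, $T(t)V\to V$ as $t\downarrow 0$ for every $V\in\mathcal{E}$, and $\|T(t)\|\le 1$ for all $t\ge 0$, whose infinitesimal generator is $\mathcal{A}$: the limit $\lim_{t\downarrow0}\frac{T(t)V-V}{t}$ exists in $\mathcal{E}$ if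 and only if $V\in\mathcal{D}(\mathcal{A})$, and it then equals $\mathcal{A}V$. -/

import Mathlib

open MeasureTheory Filter Topology TopologicalSpace
open scoped NNReal ENNReal ContDiff Distributions

/-! ### Strongly continuous semigroups and their generators -/

/-- A `C₀`-semigroup of bounded linear operators on a real normed space. -/
structure C0Semigroup (X : Type*) [NormedAddCommGroup X] [NormedSpace ℝ X] where
  /-- The operators `T(t)`, `t ≥ 0`. -/
  op : ℝ≥0 → X →L[ℝ] X
  op_zero : op 0 = ContinuousLinearMap.id ℝ X
  op_add : ∀ s t : ℝ≥0, op (s + t) = (op s).comp (op t)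
  tendsto_zero : ∀ x : X, Tendsto (fun t : ℝ≥0 => op t x) (𝓝 0) (𝓝 x)

namespace C0Semigroup

variable {X : Type*} [NormedAddCommGroup X] [NormedSpace ℝ X]

/-- A semigroup of contractions: `‖T(t)‖ ≤ 1` for all `t ≥ 0`. -/
def IsContraction (T : C0Semigroup X) : Prop :=
  ∀ t : ℝ≥0, ‖T.op t‖ ≤ 1

/-- The set of pairs `(x, y)` with `(T(t) x - x) / t → y` in `X` as `t ↓ 0`. -/
def generatorGraph (T : C0Semigroup X) : Submodule ℝ (X × X) where
  carrier := {p | Tendsto (fun t : ℝ≥0 => (t : ℝ)⁻¹ • (T.op t p.1 - p.1)) (𝓝[>] 0) (𝓝 p.2)}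
  zero_mem' := by simp
  add_mem' := by
    intro p q hp hq
    refine (Tendsto.add hp hq).congr fun t => ?_
    simp only [Prod.fst_add, map_add, ← smul_add]
    congr 1
    abel
  smul_mem' := by
    intro c p hp
    refine (Tendsto.const_smul hp c).congr fun t => ?_
    simp only [Prod.smul_fst, map_smul, ← smul_sub]
    rw [smul_comm]

/-- The infinitesimal generator: its domain consists of all `x` for which
`lim_{t ↓ 0} (T(t) x - x) / t` exists, and its value at `x` is that limit. -/
noncomputable def generator (T : C0Semigroup X) : X →ₗ.[ℝ] X :=
  T.generatorGraph.toLinearPMap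

theorem graph_generator (T : C0Semigroup X) : T.generator.graph = T.generatorGraph := by
  refine Submodule.toLinearPMap_graph_eq _ ?_
  rintro ⟨x, y⟩ hp hx
  simp only at hx
  subst hx
  have h : Tendsto (fun t : ℝ≥0 => (t : ℝ)⁻¹ • (T.op t (0 : X) - 0)) (𝓝[>] 0) (𝓝 y) := hp
  simp only [map_zero, sub_zero, smul_zero] at h
  exact (tendsto_nhds_unique h tendsto_const_nhds)

end C0Semigroup

/-! ### Sobolev spaces on an open subset of the real line -/

/-- The real Hilbert space `L²(Ω)`. -/
abbrev L2 (Ω : Opens ℝ) : Type :=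
  Lp ℝ 2 ((volume : Measure ℝ).restrict (Ω : Set ℝ))

/-- `g` is the weak derivative of `u` on `Ω`: `∫_Ω u φ' = - ∫_Ω g φ` for all `φ ∈ C_c^∞(Ω)`. -/
def HasWeakDeriv {Ω : Opens ℝ} (u g : L2 Ω) : Prop :=
  ∀ φ : 𝓓(Ω, ℝ), ∫ x in (Ω : Set ℝ), u x * deriv φ x = - ∫ x in (Ω : Set ℝ), g x * φ x

namespace Sobolev

variable {Ω : Opens ℝ}

theorem memLp_testFunction (φ : 𝓓(Ω, ℝ)) (p : ℝ≥0∞) :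
    MemLp φ p ((volume : Measure ℝ).restrict (Ω : Set ℝ)) :=
  (φ.continuous.memLp_of_hasCompactSupport φ.hasCompactSupport).restrict _

theorem memLp_deriv_testFunction (φ : 𝓓(Ω, ℝ)) (p : ℝ≥0∞) :
    MemLp (deriv φ) p ((volume : Measure ℝ).restrict (Ω : Set ℝ)) :=
  ((φ.contDiff.continuous_deriv (by simp)).memLp_of_hasCompactSupport
    φ.hasCompactSupport.deriv).restrict _

theorem integrable_mul_testFunction (u : L2 Ω) (φ : 𝓓(Ω, ℝ)) :
    Integrable (fun x => u x * φ x) ((volume : Measure ℝ).restrict (Ω : Set ℝ)) :=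
  (Lp.memLp u).integrable_mul (memLp_testFunction φ 2)

theorem integrable_mul_deriv_testFunction (u : L2 Ω) (φ : 𝓓(Ω, ℝ)) :
    Integrable (fun x => u x * deriv φ x) ((volume : Measure ℝ).restrict (Ω : Set ℝ)) :=
  (Lp.memLp u).integrable_mul (memLp_deriv_testFunction φ 2)

variable (Ω) in
/-- The pairs `(u, u')` with `u, u' ∈ L²(Ω)`, the derivative being taken weakly. -/
def weakDerivGraph : Submodule ℝ (L2 Ω × L2 Ω) where
  carrier := {p | HasWeakDeriv p.1 p.2}
  zero_mem' := by
    intro φ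
    have h : ∀ ψ : ℝ → ℝ, ∫ x in (Ω : Set ℝ), (0 : L2 Ω) x * ψ x = 0 := by
      intro ψ
      rw [← integral_zero ℝ ℝ (μ := (volume : Measure ℝ).restrict (Ω : Set ℝ))]
      refine integral_congr_ae ?_
      filter_upwards [Lp.coeFn_zero ℝ 2 ((volume : Measure ℝ).restrict (Ω : Set ℝ))] with x hx
      rw [hx, Pi.zero_apply, zero_mul]
    simp only [Prod.fst_zero, Prod.snd_zero, h, neg_zero]
  add_mem' := by
    intro p q hp hq φ
    have h1 : ∫ x in (Ω : Set ℝ), (p.1 + q.1 : L2 Ω) x * deriv φ x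
        = (∫ x in (Ω : Set ℝ), p.1 x * deriv φ x) + ∫ x in (Ω : Set ℝ), q.1 x * deriv φ x := by
      rw [← integral_add (integrable_mul_deriv_testFunction _ φ)
        (integrable_mul_deriv_testFunction _ φ)]
      refine integral_congr_ae ?_
      filter_upwards [Lp.coeFn_add p.1 q.1] with x hx
      rw [hx, Pi.add_apply, add_mul]
    have h2 : ∫ x in (Ω : Set ℝ), (p.2 + q.2 : L2 Ω) x * φ x
        = (∫ x in (Ω : Set ℝ), p.2 x * φ x) + ∫ x in (Ω : Set ℝ), q.2 x * φ x := by
      rw [← integral_add (integrable_mul_testFunction _ φ) (integrable_mul_testFunction _ φ)]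
      refine integral_congr_ae ?_
      filter_upwards [Lp.coeFn_add p.2 q.2] with x hx
      rw [hx, Pi.add_apply, add_mul]
    rw [Prod.fst_add, Prod.snd_add, h1, h2, hp φ, hq φ, neg_add]
  smul_mem' := by
    intro c p hp φ
    have h (u : L2 Ω) (ψ : ℝ → ℝ) : ∫ x in (Ω : Set ℝ), (c • u : L2 Ω) x * ψ x
        = c * ∫ x in (Ω : Set ℝ), u x * ψ x := by
      rw [← integral_const_mul]
      refine integral_congr_ae ?_
      filter_upwards [Lp.coeFn_smul c u] with x hx
      rw [hx, Pi.smul_apply, smul_eq_mul, mul_assoc]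
    rw [Prod.smul_fst, Prod.smul_snd, h, h, hp φ, mul_neg]

theorem mem_weakDerivGraph {p : L2 Ω × L2 Ω} : p ∈ weakDerivGraph Ω ↔ HasWeakDeriv p.1 p.2 :=
  Iff.rfl

/-- Weak derivatives are unique. -/
theorem eq_zero_of_hasWeakDeriv_zero {g : L2 Ω} (h : HasWeakDeriv 0 g) : g = 0 := by
  have hg : ∀ φ : 𝓓(Ω, ℝ), ∫ x in (Ω : Set ℝ), g x * φ x = 0 := by
    intro φ
    have h1 := h φ
    have h2 : ∫ x in (Ω : Set ℝ), (0 : L2 Ω) x * deriv φ x = 0 := by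
      rw [← integral_zero ℝ ℝ (μ := (volume : Measure ℝ).restrict (Ω : Set ℝ))]
      refine integral_congr_ae ?_
      filter_upwards [Lp.coeFn_zero ℝ 2 ((volume : Measure ℝ).restrict (Ω : Set ℝ))] with x hx
      rw [hx, Pi.zero_apply, zero_mul]
    linarith
  have hloc : LocallyIntegrableOn g (Ω : Set ℝ) volume := by
    rw [locallyIntegrableOn_iff Ω.isOpen.isLocallyClosed]
    intro K hK hKc
    have hm : MemLp g 2 ((volume : Measure ℝ).restrict K) :=
      (Lp.memLp g).mono_measure (Measure.restrict_mono hK le_rfl)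
    have : IsFiniteMeasure ((volume : Measure ℝ).restrict K) :=
      ⟨by simpa using hKc.measure_lt_top⟩
    exact hm.integrable (by norm_num)
  have key := Ω.isOpen.ae_eq_zero_of_integral_contDiff_smul_eq_zero hloc (by
    intro ψ h1 h2 h3
    have := hg ⟨ψ, h1, h2, h3⟩
    rw [← this, ← setIntegral_eq_integral_of_forall_compl_eq_zero (s := (Ω : Set ℝ))]
    · refine integral_congr_ae (Eventually.of_forall fun x => ?_)
      simp [mul_comm]
    · intro x hx
      have : ψ x = 0 := image_eq_zero_of_notMem_tsupport fun hx' => hx (h3 hx')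
      simp [this])
  rw [Lp.eq_zero_iff_ae_eq_zero]
  exact (ae_restrict_iff' Ω.isOpen.measurableSet).2 key

variable (Ω) in
/-- The weak derivative `u ↦ u_x` as an unbounded operator on `L²(Ω)`. -/
noncomputable def weakDeriv : L2 Ω →ₗ.[ℝ] L2 Ω :=
  (weakDerivGraph Ω).toLinearPMap

theorem graph_weakDeriv : (weakDeriv Ω).graph = weakDerivGraph Ω := by
  refine Submodule.toLinearPMap_graph_eq _ ?_
  rintro ⟨x, y⟩ hp hx
  simp only at hx
  subst hx
  exact eq_zero_of_hasWeakDeriv_zero hp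

variable (Ω) in
/-- The pairs `(u, u'')` with `u, u', u'' ∈ L²(Ω)`, the derivatives being taken weakly. -/
def weakDerivTwoGraph : Submodule ℝ (L2 Ω × L2 Ω) where
  carrier := {p | ∃ g : L2 Ω, HasWeakDeriv p.1 g ∧ HasWeakDeriv g p.2}
  zero_mem' := ⟨0, (weakDerivGraph Ω).zero_mem, (weakDerivGraph Ω).zero_mem⟩
  add_mem' := by
    rintro p q ⟨g, hg, hg'⟩ ⟨k, hk, hk'⟩
    exact ⟨g + k, (weakDerivGraph Ω).add_mem (x := (p.1, g)) (y := (q.1, k)) hg hk,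
      (weakDerivGraph Ω).add_mem (x := (g, p.2)) (y := (k, q.2)) hg' hk'⟩
  smul_mem' := by
    rintro c p ⟨g, hg, hg'⟩
    exact ⟨c • g, (weakDerivGraph Ω).smul_mem c (x := (p.1, g)) hg,
      (weakDerivGraph Ω).smul_mem c (x := (g, p.2)) hg'⟩

variable (Ω) in
/-- The second weak derivative `u ↦ u_xx` as an unbounded operator on `L²(Ω)`. -/
noncomputable def weakDerivTwo : L2 Ω →ₗ.[ℝ] L2 Ω :=
  (weakDerivTwoGraph Ω).toLinearPMap

theorem graph_weakDerivTwo : (weakDerivTwo Ω).graph = weakDerivTwoGraph Ω := by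
  refine Submodule.toLinearPMap_graph_eq _ ?_
  rintro ⟨x, y⟩ ⟨g, hg, hg'⟩ hx
  simp only at hx
  subst hx
  obtain rfl := eq_zero_of_hasWeakDeriv_zero hg
  exact eq_zero_of_hasWeakDeriv_zero hg'

variable (Ω) in
/-- The Sobolev space `H¹(Ω)`. -/
noncomputable def H1 : Submodule ℝ (L2 Ω) := (weakDeriv Ω).domain

variable (Ω) in
/-- The Sobolev space `H²(Ω)`. -/
noncomputable def H2 : Submodule ℝ (L2 Ω) := (weakDerivTwo Ω).domain

theorem mem_H1 {u : L2 Ω} : u ∈ H1 Ω ↔ ∃ g : L2 Ω, HasWeakDeriv u g := by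
  simp [H1, weakDeriv, Submodule.toLinearPMap_domain, mem_weakDerivGraph]

theorem mem_H2 {u : L2 Ω} :
    u ∈ H2 Ω ↔ ∃ g h : L2 Ω, HasWeakDeriv u g ∧ HasWeakDeriv g h := by
  simp only [H2, weakDerivTwo, Submodule.toLinearPMap_domain, Submodule.mem_map,
    LinearMap.fst_apply, Prod.exists, exists_and_right, exists_eq_right]
  exact exists_comm

variable (Ω) in
/-- The class in `L²(Ω)` of a test function. -/
noncomputable def testToL2 : 𝓓(Ω, ℝ) →ₗ[ℝ] L2 Ω where
  toFun φ := (memLp_testFunction φ 2).toLp φ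
  map_add' φ ψ := MemLp.toLp_add (memLp_testFunction φ 2) (memLp_testFunction ψ 2)
  map_smul' c φ := MemLp.toLp_const_smul c (memLp_testFunction φ 2)

variable (Ω) in
/-- The class in `L²(Ω)` of the derivative of a test function. -/
noncomputable def testDerivToL2 : 𝓓(Ω, ℝ) →ₗ[ℝ] L2 Ω where
  toFun φ := (memLp_deriv_testFunction φ 2).toLp (deriv φ)
  map_add' φ ψ := by
    rw [← MemLp.toLp_add (memLp_deriv_testFunction φ 2) (memLp_deriv_testFunction ψ 2)]
    refine MemLp.toLp_congr _ _ (Eventually.of_forall fun x => ?_)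
    exact deriv_add (φ.contDiff.differentiable (by simp) x)
      (ψ.contDiff.differentiable (by simp) x)
  map_smul' c φ := by
    rw [RingHom.id_apply, ← MemLp.toLp_const_smul c (memLp_deriv_testFunction φ 2)]
    refine MemLp.toLp_congr _ _ (Eventually.of_forall fun x => ?_)
    exact deriv_const_smul c (φ.contDiff.differentiable (by simp) x)

variable (Ω) in
/-- The pairs `(φ, φ')` in `L²(Ω) × L²(Ω)` with `φ ∈ C_c^∞(Ω)`. -/
noncomputable def testGraph : Submodule ℝ (L2 Ω × L2 Ω) :=
  LinearMap.range ((testToL2 Ω).prod (testDerivToL2 Ω))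

variable (Ω) in
/-- The Sobolev space `H¹₀(Ω)`, the closure of `C_c^∞(Ω)` in `H¹(Ω)`: the functions `u` with a weak
derivative `u' ∈ L²(Ω)` for which some test functions `φ` satisfy `φ → u` and `φ' → u'` in `L²(Ω)`.
(The product topology on the pairs `(u, u')` is the topology of the `H¹` norm.) -/
noncomputable def H10 : Submodule ℝ (L2 Ω) :=
  (weakDerivGraph Ω ⊓ (testGraph Ω).topologicalClosure).map (LinearMap.fst ℝ (L2 Ω) (L2 Ω))

theorem mem_H10 {u : L2 Ω} :
    u ∈ H10 Ω ↔ ∃ g : L2 Ω, HasWeakDeriv u g ∧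
      (u, g) ∈ closure (testGraph Ω : Set (L2 Ω × L2 Ω)) := by
  simp only [H10, Submodule.mem_map, LinearMap.fst_apply, Prod.exists, exists_and_right,
    exists_eq_right]
  rfl

end Sobolev

/-! ### The operator -/

/-- The real Hilbert space `L²(Ω) × L²(Ω)`, with
`⟪(u₁, v₁), (u₂, v₂)⟫ = ∫_Ω u₁ u₂ + ∫_Ω v₁ v₂`. -/
abbrev EnergySpace (Ω : Opens ℝ) : Type := WithLp 2 (L2 Ω × L2 Ω)

open Sobolev in
/-- The domain `(H²(Ω) ∩ H¹₀(Ω)) × (H²(Ω) ∩ H¹₀(Ω))`. -/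
noncomputable def diffusionDomain (Ω : Opens ℝ) : Submodule ℝ (EnergySpace Ω) where
  carrier := {V | V.fst ∈ H2 Ω ⊓ H10 Ω ∧ V.snd ∈ H2 Ω ⊓ H10 Ω}
  zero_mem' := ⟨zero_mem (H2 Ω ⊓ H10 Ω), zero_mem (H2 Ω ⊓ H10 Ω)⟩
  add_mem' := fun hV hW =>
    ⟨(H2 Ω ⊓ H10 Ω).add_mem hV.1 hW.1, (H2 Ω ⊓ H10 Ω).add_mem hV.2 hW.2⟩
  smul_mem' := fun c _ hV =>
    ⟨(H2 Ω ⊓ H10 Ω).smul_mem c hV.1, (H2 Ω ⊓ H10 Ω).smul_mem c hV.2⟩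

open Sobolev in
/-- The operator `A (u, v) = (u_xx, v_xx)` on `L²(Ω) × L²(Ω)` with domain
`(H²(Ω) ∩ H¹₀(Ω)) × (H²(Ω) ∩ H¹₀(Ω))`. -/
noncomputable def diffusionOperator (Ω : Opens ℝ) : EnergySpace Ω →ₗ.[ℝ] EnergySpace Ω where
  domain := diffusionDomain Ω
  toFun :=
    { toFun := fun V => WithLp.toLp 2
        (weakDerivTwo Ω ⟨V.1.fst, V.2.1.1⟩, weakDerivTwo Ω ⟨V.1.snd, V.2.2.1⟩)
      map_add' := fun V W => by
        have h1 := (weakDerivTwo Ω).map_add ⟨V.1.fst, V.2.1.1⟩ ⟨W.1.fst, W.2.1.1⟩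
        have h2 := (weakDerivTwo Ω).map_add ⟨V.1.snd, V.2.2.1⟩ ⟨W.1.snd, W.2.2.1⟩
        exact congrArg (WithLp.toLp 2) (Prod.ext h1 h2)
      map_smul' := fun c V => by
        have h1 := (weakDerivTwo Ω).map_smul c ⟨V.1.fst, V.2.1.1⟩
        have h2 := (weakDerivTwo Ω).map_smul c ⟨V.1.snd, V.2.2.1⟩
        exact congrArg (WithLp.toLp 2) (Prod.ext h1 h2) }

/-! The operator is maximal dissipative, and on a Hilbert space such an operator generates a
contraction semigroup (Lumer–Phillips). Dissipativity is integration by parts: for u in H² ∩ H¹₀ one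
has ⟨u'', u⟩ = -‖u'‖². Surjectivity of c - A for c > 0 is solved in each component by an orthogonal
projection onto H¹₀ in the energy norm c‖u‖² + ‖u'‖² (`exists_weak_solution`); the equation itself
then shows that the solution lies in H².

The abstract part is the Yosida approximation. The bounded operators B = c A (c - A)⁻¹ commute, are
dissipative and tend to A on its dense domain as c → ∞. Their exponentials are contractions that
differ at x by at most t‖Bx - B'x‖ (`norm_exp_smul_apply_sub_le`), so they converge strongly to a
semigroup whose generator extends A. That generator is again dissipative, and surjectivity of 1 - A
leaves no room for a proper extension. -/

/-! ### Exponentials of bounded operators -/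

section Exponential

variable {X : Type*} [NormedAddCommGroup X] [NormedSpace ℝ X] [CompleteSpace X]

theorem hasDerivAt_exp_smul_apply (B : X →L[ℝ] X) (x : X) (t : ℝ) :
    HasDerivAt (fun s : ℝ => NormedSpace.exp (s • B) x) (B (NormedSpace.exp (t • B) x)) t := by
  simpa using (hasDerivAt_exp_smul_const' (𝕂 := ℝ) B t).clm_apply (hasDerivAt_const t x)

theorem exp_add_smul (B : X →L[ℝ] X) (s t : ℝ) :
    NormedSpace.exp ((s + t) • B) = NormedSpace.exp (s • B) * NormedSpace.exp (t • B) := by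
  let _ : NormedAlgebra ℚ (X →L[ℝ] X) := .restrictScalars ℚ ℝ _
  rw [add_smul, NormedSpace.exp_add_of_commute]
  exact ((Commute.refl B).smul_left s).smul_right t

/-- Comparison of the exponentials of two commuting operators which both generate contractions. -/
theorem norm_exp_smul_apply_sub_le {B C : X →L[ℝ] X} (h : Commute B C)
    (hB : ∀ t : ℝ, 0 ≤ t → ‖NormedSpace.exp (t • B)‖ ≤ 1)
    (hC : ∀ t : ℝ, 0 ≤ t → ‖NormedSpace.exp (t • C)‖ ≤ 1) (x : X) {t : ℝ} (ht : 0 ≤ t) :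
    ‖NormedSpace.exp (t • B) x - NormedSpace.exp (t • C) x‖ ≤ t * ‖B x - C x‖ := by
  -- The path e^{sB} e^{(t-s)C} x joins e^{tC} x to e^{tB} x; commutativity collects its derivative
  -- into a contraction applied to Bx - Cx.
  have hderiv : ∀ s ∈ Set.Icc (0 : ℝ) t, HasDerivWithinAt
      (fun s : ℝ => (NormedSpace.exp (s • B) * NormedSpace.exp ((t - s) • C)) x)
      ((NormedSpace.exp (s • B) * NormedSpace.exp ((t - s) • C)) (B x - C x))
      (Set.Icc 0 t) s := by
    intro s _
    have h1 := hasDerivAt_exp_smul_const (𝕂 := ℝ) B s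
    have h2 := (hasDerivAt_exp_smul_const' (𝕂 := ℝ) C (t - s)).scomp s
      ((hasDerivAt_id s).const_sub t)
    have h3 := ((h1.mul h2).clm_apply (hasDerivAt_const s x)).hasDerivWithinAt (s := Set.Icc 0 t)
    have hBC : Commute B (NormedSpace.exp ((t - s) • C)) := (h.smul_right (t - s)).exp_right
    have hCC : Commute C (NormedSpace.exp ((t - s) • C)) :=
      ((Commute.refl C).smul_right (t - s)).exp_right
    have hmul : NormedSpace.exp (s • B) * NormedSpace.exp ((t - s) • C) * (B - C)
        = NormedSpace.exp (s • B) * B * NormedSpace.exp ((t - s) • C)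
          + NormedSpace.exp (s • B) * (-1 : ℝ) • (C * NormedSpace.exp ((t - s) • C)) := by
      rw [mul_sub, mul_assoc _ _ B, ← hBC.eq, mul_assoc _ _ C, ← hCC.eq, neg_one_smul, mul_neg,
        ← sub_eq_add_neg, mul_assoc]
    have hx := congrArg (fun L : X →L[ℝ] X => L x) hmul
    exact h3.congr_deriv (by rw [map_zero, add_zero]; exact hx.symm)
  have hbound : ∀ s ∈ Set.Ico (0 : ℝ) t,
      ‖(NormedSpace.exp (s • B) * NormedSpace.exp ((t - s) • C)) (B x - C x)‖ ≤ ‖B x - C x‖ := by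
    intro s hs
    have hm : ‖NormedSpace.exp (s • B) * NormedSpace.exp ((t - s) • C)‖ ≤ 1 :=
      (norm_mul_le _ _).trans
        (mul_le_one₀ (hB s hs.1) (norm_nonneg _) (hC (t - s) (sub_nonneg.2 hs.2.le)))
    simpa using ContinuousLinearMap.le_of_opNorm_le _ hm (B x - C x)
  have key := norm_image_sub_le_of_norm_deriv_le_segment' hderiv hbound t (Set.right_mem_Icc.2 ht)
  simpa [mul_comm] using key

end Exponential

/-! ### Bounded dissipative operators -/

section Dissipative

variable {X : Type*} [NormedAddCommGroup X] [InnerProductSpace ℝ X] [CompleteSpace X]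

/-- A bounded dissipative operator generates contractions. -/
theorem norm_exp_smul_le_one {B : X →L[ℝ] X} (hB : ∀ x, inner ℝ (B x) x ≤ 0) {t : ℝ}
    (ht : 0 ≤ t) : ‖NormedSpace.exp (t • B)‖ ≤ 1 := by
  refine ContinuousLinearMap.opNorm_le_bound _ zero_le_one fun x => ?_
  have hd (s : ℝ) := (hasDerivAt_exp_smul_apply B x s).norm_sq
  -- Along an orbit y(s), the derivative of ‖y‖² is 2⟨By, y⟩ ≤ 0.
  have hanti : Antitone fun s : ℝ => ‖NormedSpace.exp (s • B) x‖ ^ 2 :=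
    antitone_of_deriv_nonpos (fun s => (hd s).differentiableAt) fun s => by
      rw [(hd s).deriv, real_inner_comm]
      linarith [hB (NormedSpace.exp (s • B) x)]
  have := hanti ht
  simp only [zero_smul, NormedSpace.exp_zero, one_apply_eq_self] at this
  simpa using (pow_le_pow_iff_left₀ (norm_nonneg _) (norm_nonneg _) two_ne_zero).1 this

end Dissipative

/-! ### Strong limits of contraction semigroups -/

section Limit

variable {X : Type*} [NormedAddCommGroup X] [NormedSpace ℝ X] [CompleteSpace X]

/-- A bounded sequence of operators which converges on a dense set converges everywhere. -/
theorem exists_tendsto_of_dense {E : ℕ → X →L[ℝ] X} (hE : ∀ n, ‖E n‖ ≤ 1) {D : Set X}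
    (hD : Dense D) (hconv : ∀ x ∈ D, CauchySeq fun n => E n x) (x : X) :
    ∃ y, Tendsto (fun n => E n x) atTop (𝓝 y) := by
  refine cauchySeq_tendsto_of_complete (Metric.cauchySeq_iff'.2 fun ε hε => ?_)
  obtain ⟨d, hd, hxd⟩ := Metric.dense_iff.1 hD x (ε / 3) (by positivity)
  obtain ⟨N, hN⟩ := Metric.cauchySeq_iff'.1 (hconv d hxd) (ε / 3) (by positivity)
  refine ⟨N, fun n hn => ?_⟩
  have hle (k : ℕ) : dist (E k x) (E k d) ≤ dist x d := by
    simpa [dist_eq_norm] using ContinuousLinearMap.le_of_opNorm_le _ (hE k) (x - d)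
  have h1 := hle n
  have h2 := hle N
  have h3 := hN n hn
  rw [Metric.mem_ball, dist_comm] at hd
  have h4 := dist_triangle4 (E n x) (E n d) (E N d) (E N x)
  rw [dist_comm (E N d)] at h4
  linarith

/-- The limit of the exponentials of a sequence of commuting generators of contractions which
converges on a dense set. -/
theorem exists_contraction_semigroup_of_tendsto {B : ℕ → X →L[ℝ] X}
    (hcomm : ∀ m n, Commute (B m) (B n))
    (hB : ∀ n, ∀ t : ℝ, 0 ≤ t → ‖NormedSpace.exp (t • B n)‖ ≤ 1) {D : Set X} (hD : Dense D)
    {a : X → X} (ha : ∀ x ∈ D, Tendsto (fun n => B n x) atTop (𝓝 (a x))) :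
    ∃ T : C0Semigroup X, T.IsContraction ∧ ∀ x ∈ D, (x, a x) ∈ T.generatorGraph := by
  have hdiff (m n : ℕ) (t : ℝ≥0) (x : X) :
      ‖NormedSpace.exp ((t : ℝ) • B m) x - NormedSpace.exp ((t : ℝ) • B n) x‖
        ≤ t * ‖B m x - B n x‖ :=
    norm_exp_smul_apply_sub_le (hcomm m n) (hB m) (hB n) x t.2
  have hcauchy (t : ℝ≥0) (x : X) (hx : x ∈ D) :
      CauchySeq fun n => NormedSpace.exp ((t : ℝ) • B n) x := by
    have h0 := cauchySeq_iff_tendsto_dist_atTop_0.1 (ha x hx).cauchySeq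
    have h1 := h0.const_mul (t : ℝ)
    rw [mul_zero] at h1
    refine cauchySeq_iff_tendsto_dist_atTop_0.2
      (squeeze_zero (fun _ => dist_nonneg) (fun p => ?_) h1)
    simpa [dist_eq_norm] using hdiff p.1 p.2 t x
  choose S hS using fun (t : ℝ≥0) (x : X) =>
    exists_tendsto_of_dense (fun n => hB n t t.2) hD (hcauchy t) x
  have hSnorm (t : ℝ≥0) (x : X) : ‖S t x‖ ≤ 1 * ‖x‖ :=
    le_of_tendsto (hS t x).norm <| Eventually.of_forall fun n =>
      ContinuousLinearMap.le_of_opNorm_le _ (hB n t t.2) x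
  let op (t : ℝ≥0) : X →L[ℝ] X := LinearMap.mkContinuous
    { toFun := S t
      map_add' := fun x y => tendsto_nhds_unique (hS t (x + y))
        (by simpa using (hS t x).add (hS t y))
      map_smul' := fun c x => tendsto_nhds_unique (hS t (c • x))
        (by simpa using (hS t x).const_smul c) } 1 (hSnorm t)
  have hop (t : ℝ≥0) (x : X) :
      Tendsto (fun n => NormedSpace.exp ((t : ℝ) • B n) x) atTop (𝓝 (op t x)) := hS t x
  have hopnorm (t : ℝ≥0) : ‖op t‖ ≤ 1 := LinearMap.mkContinuous_norm_le _ zero_le_one _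
  -- Letting m → ∞ in `hdiff` keeps the factor t, so the error stays small uniformly in t after
  -- division by t; this is what lets the derivative at 0 pass to the limit.
  have hlim (x : X) (hx : x ∈ D) (n : ℕ) (t : ℝ≥0) :
      ‖op t x - NormedSpace.exp ((t : ℝ) • B n) x‖ ≤ t * ‖a x - B n x‖ :=
    le_of_tendsto_of_tendsto ((hop t x).sub_const _).norm
      (((ha x hx).sub_const _).norm.const_mul _) (Eventually.of_forall fun m => hdiff m n t x)
  have hgen (x : X) (hx : x ∈ D) :
      Tendsto (fun t : ℝ≥0 => (t : ℝ)⁻¹ • (op t x - x)) (𝓝[>] 0) (𝓝 (a x)) := by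
    rw [Metric.tendsto_nhds]
    intro ε hε
    obtain ⟨n, hn⟩ := ((Metric.tendsto_nhds.1 (ha x hx)) (ε / 3) (by positivity)).exists
    have hslope := (hasDerivAt_exp_smul_apply (B n) x 0).tendsto_slope_zero_right
    have hcoe : Tendsto (fun t : ℝ≥0 => (t : ℝ)) (𝓝[>] 0) (𝓝[>] 0) := by
      refine tendsto_nhdsWithin_iff.2 ⟨?_, ?_⟩
      · exact (NNReal.continuous_coe.tendsto' 0 0 NNReal.coe_zero).mono_left nhdsWithin_le_nhds
      · filter_upwards [self_mem_nhdsWithin] with t ht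
        exact NNReal.coe_pos.2 ht
    filter_upwards [(Metric.tendsto_nhds.1 (hslope.comp hcoe)) (ε / 3) (by positivity),
      self_mem_nhdsWithin] with t ht htpos
    have htp : (0 : ℝ) < t := NNReal.coe_pos.2 htpos
    simp only [Function.comp_apply, zero_add, zero_smul, NormedSpace.exp_zero,
      one_apply_eq_self] at ht
    have h1 : dist ((t : ℝ)⁻¹ • (op t x - x))
        ((t : ℝ)⁻¹ • (NormedSpace.exp ((t : ℝ) • B n) x - x)) ≤ dist (B n x) (a x) := by
      rw [dist_eq_norm, ← smul_sub, sub_sub_sub_cancel_right, norm_smul, norm_inv,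
        Real.norm_of_nonneg htp.le, inv_mul_le_iff₀ htp, dist_comm, dist_eq_norm]
      exact hlim x hx n t
    have h2 := dist_triangle4 ((t : ℝ)⁻¹ • (op t x - x))
      ((t : ℝ)⁻¹ • (NormedSpace.exp ((t : ℝ) • B n) x - x)) (B n x) (a x)
    linarith
  have hcont (x : X) (hx : x ∈ D) (t : ℝ≥0) : ‖op t x - x‖ ≤ t * ‖a x‖ := by
    refine le_of_tendsto_of_tendsto ((hop t x).sub_const _).norm
      ((ha x hx).norm.const_mul _) (Eventually.of_forall fun m => ?_)
    -- Comparison with the zero operator, whose exponential is the identity.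
    have := norm_exp_smul_apply_sub_le (Commute.zero_right (B m)) (hB m)
      (fun s _ => by
        rw [smul_zero, NormedSpace.exp_zero]
        exact ContinuousLinearMap.norm_id_le) x t.2
    simpa using this
  refine ⟨⟨op, ?_, ?_, ?_⟩, hopnorm, hgen⟩
  · ext x
    refine tendsto_nhds_unique (hop 0 x) ?_
    simp
  · intro s t
    ext x
    refine tendsto_nhds_unique (hop (s + t) x) ?_
    have h1 := hop s (op t x)
    -- Strong limits are compatible with products here because the outer factors are contractions.
    have h2 : Tendsto (fun n => NormedSpace.exp ((s : ℝ) • B n)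
        (NormedSpace.exp ((t : ℝ) • B n) x - op t x)) atTop (𝓝 0) := by
      refine squeeze_zero_norm (fun n => ?_)
        (tendsto_iff_norm_sub_tendsto_zero.1 (hop t x))
      simpa only [one_mul] using ContinuousLinearMap.le_of_opNorm_le _ (hB n s s.2)
        (NormedSpace.exp ((t : ℝ) • B n) x - op t x)
    have h3 := h2.add h1
    rw [zero_add] at h3
    refine h3.congr fun n => ?_
    rw [NNReal.coe_add, exp_add_smul, mul_apply_eq_comp, map_sub, sub_add_cancel]
  · intro x
    rw [Metric.tendsto_nhds]
    intro ε hε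
    obtain ⟨d, hd, hxd⟩ := Metric.dense_iff.1 hD x (ε / 3) (by positivity)
    have h0 : Tendsto (fun t : ℝ≥0 => (t : ℝ) * ‖a d‖) (𝓝 0) (𝓝 0) := by
      have := (NNReal.continuous_coe.tendsto 0).mul_const ‖a d‖
      simpa using this
    filter_upwards [h0.eventually_lt_const (show 0 < ε / 3 by positivity)] with t ht
    have h1 : dist (op t x) (op t d) ≤ dist x d := by
      simpa [dist_eq_norm] using ContinuousLinearMap.le_of_opNorm_le _ (hopnorm t) (x - d)
    have h2 : dist (op t d) d ≤ t * ‖a d‖ := by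
      rw [dist_eq_norm]; exact hcont d hxd t
    have h3 := dist_triangle4 (op t x) (op t d) d x
    rw [Metric.mem_ball] at hd
    rw [dist_comm x d] at h1
    linarith

end Limit

/-! ### The Lumer–Phillips theorem -/

section MaximalDissipative

variable {X : Type*} [NormedAddCommGroup X] [InnerProductSpace ℝ X]

/-- For a dissipative operator `A`, the operator `c - A` is bounded below by `c`. -/
theorem LinearPMap.mul_norm_le_of_dissipative {A : X →ₗ.[ℝ] X}
    (hA : ∀ x : A.domain, inner ℝ (A x) (x : X) ≤ 0) (c : ℝ) (x : A.domain) :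
    c * ‖(x : X)‖ ≤ ‖c • (x : X) - A x‖ := by
  rcases (norm_nonneg (x : X)).eq_or_lt with h0 | hpos
  · rw [← h0, mul_zero]
    exact norm_nonneg _
  · refine le_of_mul_le_mul_right ?_ hpos
    have h1 := real_inner_le_norm (c • (x : X) - A x) (x : X)
    rw [inner_sub_left, real_inner_smul_left, real_inner_self_eq_norm_sq] at h1
    linarith [hA x]

/-- The resolvent `(c - A)⁻¹` of a maximal dissipative operator. -/
theorem LinearPMap.exists_resolvent {A : X →ₗ.[ℝ] X}
    (hA : ∀ x : A.domain, inner ℝ (A x) (x : X) ≤ 0) {c : ℝ} (hc : 0 < c)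
    (hr : ∀ f : X, ∃ x : A.domain, c • (x : X) - A x = f) :
    ∃ R : X →L[ℝ] X, (∀ f, ‖R f‖ ≤ c⁻¹ * ‖f‖) ∧
      (∀ f, ∃ x : A.domain, (x : X) = R f ∧ c • (x : X) - A x = f) ∧
      ∀ x : A.domain, R (c • (x : X) - A x) = x := by
  let L : A.domain →ₗ[ℝ] X := c • A.domain.subtype - A.toFun
  have hL (x : A.domain) : L x = c • (x : X) - A x := rfl
  have hinj : Function.Injective L := by
    refine (injective_iff_map_eq_zero L).2 fun x hx => ?_
    have h1 := mul_norm_le_of_dissipative hA c x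
    rw [← hL, hx, norm_zero] at h1
    have h2 : ‖(x : X)‖ ≤ 0 := nonpos_of_mul_nonpos_right h1 hc
    exact Subtype.ext (norm_le_zero_iff.1 h2)
  let e := LinearEquiv.ofBijective L ⟨hinj, hr⟩
  have he (f : X) : c • (e.symm f : X) - A (e.symm f) = f := e.apply_symm_apply f
  have hbound (f : X) : ‖(A.domain.subtype ∘ₗ e.symm.toLinearMap) f‖ ≤ c⁻¹ * ‖f‖ := by
    have h1 := mul_norm_le_of_dissipative hA c (e.symm f)
    rw [he] at h1
    rw [inv_mul_eq_div, le_div_iff₀' hc]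
    exact h1
  refine ⟨LinearMap.mkContinuous _ c⁻¹ hbound, hbound, fun f => ⟨e.symm f, rfl, he f⟩, fun x => ?_⟩
  exact congrArg Subtype.val (e.symm_apply_apply x)

/-- The generator of a contraction semigroup is dissipative. -/
theorem C0Semigroup.inner_le_zero_of_mem_generatorGraph {T : C0Semigroup X}
    (hT : T.IsContraction) {x y : X} (h : (x, y) ∈ T.generatorGraph) : inner ℝ y x ≤ 0 := by
  have h1 : Tendsto (fun t : ℝ≥0 => (t : ℝ)⁻¹ • (T.op t x - x)) (𝓝[>] 0) (𝓝 y) := h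
  refine le_of_tendsto (h1.inner tendsto_const_nhds) (Eventually.of_forall fun t => ?_)
  rw [real_inner_smul_left, inner_sub_left, real_inner_self_eq_norm_sq]
  refine mul_nonpos_of_nonneg_of_nonpos (inv_nonneg.2 t.2) ?_
  have h2 := real_inner_le_norm (T.op t x) x
  have h3 : ‖T.op t x‖ ≤ ‖x‖ := by simpa using ContinuousLinearMap.le_of_opNorm_le _ (hT t) x
  nlinarith [norm_nonneg x]

variable [CompleteSpace X]

/-- A maximal dissipative operator on a Hilbert space is densely defined. -/
theorem LinearPMap.dense_domain_of_dissipative {A : X →ₗ.[ℝ] X}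
    (hA : ∀ x : A.domain, inner ℝ (A x) (x : X) ≤ 0)
    (hr : ∀ f : X, ∃ x : A.domain, (1 : ℝ) • (x : X) - A x = f) :
    Dense (A.domain : Set X) := by
  rw [Submodule.dense_iff_topologicalClosure_eq_top, Submodule.topologicalClosure_eq_top_iff,
    Submodule.eq_bot_iff]
  intro v hv
  -- With v = x - Ax orthogonal to the domain, 0 = ⟨v, x⟩ = ‖x‖² - ⟨Ax, x⟩ ≥ ‖x‖², so x = 0 and v =
  -- 0.
  obtain ⟨x, hx⟩ := hr v
  have h1 : inner ℝ (x : X) v = 0 := (Submodule.mem_orthogonal _ _).1 hv x x.2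
  rw [real_inner_comm, ← hx, inner_sub_left, one_smul, real_inner_self_eq_norm_sq] at h1
  have h2 : (x : X) = 0 := by
    have : ‖(x : X)‖ ^ 2 ≤ 0 := by linarith [hA x]
    exact norm_eq_zero.1 (pow_eq_zero_iff two_ne_zero |>.1 (this.antisymm (sq_nonneg _)))
  have h3 : x = 0 := Subtype.ext h2
  rw [← hx, h3, A.map_zero]
  simp

/-- **Lumer–Phillips theorem** on a Hilbert space: a maximal dissipative operator generates a
`C₀`-semigroup of contractions. -/
theorem exists_contraction_semigroup_generator_eq {A : X →ₗ.[ℝ] X}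
    (hA : ∀ x : A.domain, inner ℝ (A x) (x : X) ≤ 0)
    (hr : ∀ c : ℝ, 0 < c → ∀ f : X, ∃ x : A.domain, c • (x : X) - A x = f) :
    ∃ T : C0Semigroup X, T.IsContraction ∧ T.generator = A := by
  have hdense := LinearPMap.dense_domain_of_dissipative hA (hr 1 one_pos)
  -- The shift by 1 keeps the parameter positive at n = 0.
  let c (n : ℕ) : ℝ := n + 1
  have hc (n : ℕ) : 0 < c n := Nat.cast_add_one_pos n
  choose R hRnorm hRrange hRleft using fun n =>
    LinearPMap.exists_resolvent hA (hc n) (hr (c n) (hc n))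
  have hRcomm (m n : ℕ) : Commute (R m) (R n) := by
    -- The resolvent identity; comparing it with its mirror image under m ↔ n gives commutation.
    have key (m n : ℕ) (f : X) : R m f - R n f = (c n - c m) • R m (R n f) := by
      obtain ⟨x, hx, hxf⟩ := hRrange n f
      rw [← hx, ← hxf]
      have h1 : c n • (x : X) - A x = (c m • (x : X) - A x) + (c n - c m) • (x : X) := by
        rw [sub_smul]; abel
      rw [h1, map_add, hRleft, map_smul, add_sub_cancel_left]
    rcases eq_or_ne m n with rfl | hmn
    · exact Commute.refl _
    · have hne : c n - c m ≠ 0 := by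
        simp only [c, add_sub_add_right_eq_sub, sub_ne_zero]
        exact_mod_cast hmn.symm
      ext f
      have h1 := key m n f
      have h2 := key n m f
      rw [← neg_sub (c n), neg_smul] at h2
      have h3 : (c n - c m) • (R m (R n f) - R n (R m f)) = 0 := by
        rw [smul_sub, ← h1, sub_eq_add_neg, ← h2]
        abel
      exact sub_eq_zero.1 ((smul_eq_zero.1 h3).resolve_left hne)
  -- The Yosida approximation c A R, made visibly bounded by A R = c R - 1.
  let B (n : ℕ) : X →L[ℝ] X := c n ^ 2 • R n - c n • 1
  have hBapp (n : ℕ) (x : X) : B n x = c n ^ 2 • R n x - c n • x := rfl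
  have hBcomm (m n : ℕ) : Commute (B m) (B n) := by
    refine Commute.sub_left (Commute.sub_right ?_ ?_) (Commute.sub_right ?_ ?_)
    · exact ((hRcomm m n).smul_left _).smul_right _
    · exact (Commute.one_right _).smul_right _
    · exact (Commute.one_left _).smul_left _
    · exact (Commute.one_right _).smul_right _
  have hBdiss (n : ℕ) (x : X) : inner ℝ (B n x) x ≤ 0 := by
    rw [hBapp, inner_sub_left, real_inner_smul_left, real_inner_smul_left,
      real_inner_self_eq_norm_sq]
    have h1 : inner ℝ (R n x) x ≤ (c n)⁻¹ * ‖x‖ * ‖x‖ :=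
      (real_inner_le_norm _ _).trans (mul_le_mul_of_nonneg_right (hRnorm n x) (norm_nonneg x))
    have h2 := mul_le_mul_of_nonneg_left h1 (sq_nonneg (c n))
    have h3 : c n ^ 2 * ((c n)⁻¹ * ‖x‖ * ‖x‖) = c n * ‖x‖ ^ 2 := by
      field_simp [(hc n).ne']
    linarith
  have hRA (n : ℕ) (x : A.domain) : c n • R n x = x + R n (A x) := by
    have := hRleft n x
    rw [map_sub, map_smul] at this
    exact sub_eq_iff_eq_add.1 this
  have hBA (n : ℕ) (x : A.domain) : B n x = c n • R n (A x) := by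
    rw [hBapp, pow_two, mul_smul, ← smul_sub, hRA, add_sub_cancel_left]
  have hcontr (n : ℕ) (y : X) : ‖c n • R n y‖ ≤ ‖y‖ := by
    rw [norm_smul, Real.norm_of_nonneg (hc n).le]
    have h1 := mul_le_mul_of_nonneg_left (hRnorm n y) (hc n).le
    rwa [mul_inv_cancel_left₀ (hc n).ne'] at h1
  -- On the domain c R d - d = R(A d) has norm at most c⁻¹‖A d‖; density and `hcontr` extend this to
  -- all y.
  have happrox (y : X) : Tendsto (fun n => c n • R n y) atTop (𝓝 y) := by
    rw [Metric.tendsto_nhds]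
    intro ε hε
    obtain ⟨d, hd, hyd⟩ := Metric.dense_iff.1 hdense y (ε / 3) (by positivity)
    have h0 : Tendsto (fun n => (c n)⁻¹ * ‖A ⟨d, hyd⟩‖) atTop (𝓝 0) := by
      have := (tendsto_inv_atTop_zero.comp
        (tendsto_atTop_add_const_right atTop (1 : ℝ) tendsto_natCast_atTop_atTop)).mul_const
        ‖A ⟨d, hyd⟩‖
      simpa using this
    filter_upwards [h0.eventually_lt_const (show 0 < ε / 3 by positivity)] with n hn
    have h1 : dist (c n • R n y) (c n • R n d) ≤ dist d y := by
      rw [dist_eq_norm, ← smul_sub, ← map_sub, dist_comm, dist_eq_norm]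
      exact hcontr n (y - d)
    have h2 : dist (c n • R n d) d ≤ (c n)⁻¹ * ‖A ⟨d, hyd⟩‖ := by
      rw [hRA n ⟨d, hyd⟩, dist_eq_norm, add_sub_cancel_left]
      exact hRnorm n _
    rw [Metric.mem_ball] at hd
    have h3 := dist_triangle4 (c n • R n y) (c n • R n d) d y
    linarith
  classical
  -- The value 0 off the domain plays no role.
  let a : X → X := fun x => if hx : x ∈ A.domain then A ⟨x, hx⟩ else 0
  have haA (x : A.domain) : a x = A x := dif_pos x.2
  obtain ⟨T, hT, hTA⟩ := exists_contraction_semigroup_of_tendsto hBcomm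
    (fun n t ht => norm_exp_smul_le_one (hBdiss n) ht) hdense (a := a) (fun x hx => by
      rw [haA ⟨x, hx⟩]
      exact (happrox (A ⟨x, hx⟩)).congr fun n => (hBA n ⟨x, hx⟩).symm)
  refine ⟨T, hT, LinearPMap.eq_of_eq_graph ?_⟩
  rw [C0Semigroup.graph_generator]
  have hle (x : A.domain) : ((x : X), A x) ∈ T.generatorGraph := by
    rw [← haA]
    exact hTA x x.2
  refine le_antisymm ?_ ?_
  · rintro ⟨x, y⟩ hxy
    -- Maximality: z - Az = x - y makes (x - z, x - z) a point of the generator's graph, and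
    -- dissipativity gives ‖x - z‖² ≤ 0.
    obtain ⟨z, hz⟩ := hr 1 one_pos (x - y)
    rw [one_smul] at hz
    have hsub := T.generatorGraph.sub_mem hxy (hle z)
    have hdiss := C0Semigroup.inner_le_zero_of_mem_generatorGraph hT
      (x := x - z) (y := y - A z) hsub
    have hyx : y - A z = x - z := by
      rw [sub_eq_sub_iff_sub_eq_sub, ← neg_sub x y, ← hz]
      abel
    rw [hyx, real_inner_self_eq_norm_sq] at hdiss
    have h0 : x - z = 0 :=
      norm_eq_zero.1 (pow_eq_zero_iff two_ne_zero |>.1 (hdiss.antisymm (sq_nonneg _)))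
    rw [LinearPMap.mem_graph_iff]
    exact ⟨z, (sub_eq_zero.1 h0).symm, (sub_eq_zero.1 (hyx.trans h0)).symm⟩
  · rintro ⟨x, y⟩ hxy
    obtain ⟨z, rfl, rfl⟩ := (LinearPMap.mem_graph_iff A).1 hxy
    exact hle z

end MaximalDissipative

/-! ### The Dirichlet Laplacian on L²(Ω) -/

namespace Sobolev

variable {Ω : Opens ℝ}

theorem inner_testToL2 (u : L2 Ω) (φ : 𝓓(Ω, ℝ)) :
    inner ℝ u (testToL2 Ω φ) = ∫ x in (Ω : Set ℝ), u x * φ x := by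
  rw [L2.inner_def]
  refine integral_congr_ae ?_
  filter_upwards [(memLp_testFunction φ 2).coeFn_toLp] with x hx
  change (MemLp.toLp φ (memLp_testFunction φ 2) : L2 Ω) x * u x = _
  rw [hx, mul_comm]

theorem inner_testDerivToL2 (u : L2 Ω) (φ : 𝓓(Ω, ℝ)) :
    inner ℝ u (testDerivToL2 Ω φ) = ∫ x in (Ω : Set ℝ), u x * deriv φ x := by
  rw [L2.inner_def]
  refine integral_congr_ae ?_
  filter_upwards [(memLp_deriv_testFunction φ 2).coeFn_toLp] with x hx
  change (MemLp.toLp (deriv φ) (memLp_deriv_testFunction φ 2) : L2 Ω) x * u x = _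
  rw [hx, mul_comm]

/-- Turns weak differentiability into continuous linear conditions on the Hilbert space, ready for
closure and orthogonality arguments. -/
theorem hasWeakDeriv_iff_inner {u g : L2 Ω} :
    HasWeakDeriv u g ↔
      ∀ φ : 𝓓(Ω, ℝ), inner ℝ u (testDerivToL2 Ω φ) = -inner ℝ g (testToL2 Ω φ) := by
  simp only [inner_testToL2, inner_testDerivToL2]
  rfl

theorem isClosed_weakDerivGraph : IsClosed (weakDerivGraph Ω : Set (L2 Ω × L2 Ω)) := by
  have h : (weakDerivGraph Ω : Set (L2 Ω × L2 Ω)) = ⋂ φ : 𝓓(Ω, ℝ),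
      {p | inner ℝ p.1 (testDerivToL2 Ω φ) = -inner ℝ p.2 (testToL2 Ω φ)} := by
    ext p
    simp only [Set.mem_iInter, Set.mem_ofPred_eq]
    exact hasWeakDeriv_iff_inner
  rw [h]
  exact isClosed_iInter fun φ => isClosed_eq (by fun_prop) (by fun_prop)

/-- The classical derivative of a test function is its weak derivative. -/
theorem hasWeakDeriv_testToL2 (φ : 𝓓(Ω, ℝ)) :
    HasWeakDeriv (testToL2 Ω φ) (testDerivToL2 Ω φ) := by
  intro ψ
  -- The integrands vanish off Ω, so the integration by parts takes place on the whole line, without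
  -- boundary terms.
  have h1 : ∫ x in (Ω : Set ℝ), testToL2 Ω φ x * deriv ψ x = ∫ x, φ x * deriv ψ x := by
    refine (integral_congr_ae ?_).trans
      (setIntegral_eq_integral_of_forall_compl_eq_zero fun x hx => ?_)
    · filter_upwards [(memLp_testFunction φ 2).coeFn_toLp] with x hx
      exact congrArg (· * deriv ψ x) hx
    · rw [image_eq_zero_of_notMem_tsupport fun hx' => hx (φ.tsupport_subset hx'), zero_mul]
  have h2 : ∫ x in (Ω : Set ℝ), testDerivToL2 Ω φ x * ψ x = ∫ x, deriv φ x * ψ x := by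
    refine (integral_congr_ae ?_).trans
      (setIntegral_eq_integral_of_forall_compl_eq_zero fun x hx => ?_)
    · filter_upwards [(memLp_deriv_testFunction φ 2).coeFn_toLp] with x hx
      exact congrArg (· * ψ x) hx
    · rw [image_eq_zero_of_notMem_tsupport fun hx' => hx (ψ.tsupport_subset hx'), mul_zero]
  have hφ' : Continuous (deriv φ) := φ.contDiff.continuous_deriv (by simp)
  have hψ' : Continuous (deriv ψ) := ψ.contDiff.continuous_deriv (by simp)
  rw [h1, h2]
  exact integral_mul_deriv_eq_deriv_mul_of_integrable
    (fun x _ => (φ.contDiff.differentiable (by simp) x).hasDerivAt)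
    (fun x _ => (ψ.contDiff.differentiable (by simp) x).hasDerivAt)
    ((φ.continuous.mul hψ').integrable_of_hasCompactSupport φ.hasCompactSupport.mul_right)
    ((hφ'.mul ψ.continuous).integrable_of_hasCompactSupport ψ.hasCompactSupport.mul_left)
    ((φ.continuous.mul ψ.continuous).integrable_of_hasCompactSupport
      φ.hasCompactSupport.mul_right)

/-- A limit of pairs (φ, φ') is automatically a function with its weak derivative, because the weak
derivative is a closed operator. -/
theorem closure_testGraph_subset :
    closure (testGraph Ω : Set (L2 Ω × L2 Ω)) ⊆ weakDerivGraph Ω := by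
  refine closure_minimal ?_ isClosed_weakDerivGraph
  rintro _ ⟨φ, rfl⟩
  exact hasWeakDeriv_testToL2 φ

/-- Integration by parts against an element of `H¹₀(Ω)`. -/
theorem inner_weakDeriv_eq_neg_inner {u u' g h : L2 Ω}
    (hu : (u, u') ∈ closure (testGraph Ω : Set (L2 Ω × L2 Ω))) (hg : HasWeakDeriv g h) :
    inner ℝ g u' = -inner ℝ h u := by
  have hc : IsClosed {p : L2 Ω × L2 Ω | inner ℝ g p.2 = -inner ℝ h p.1} :=
    isClosed_eq (by fun_prop) (by fun_prop)
  refine closure_minimal ?_ hc hu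
  rintro _ ⟨φ, rfl⟩
  exact hasWeakDeriv_iff_inner.1 hg φ

theorem hasWeakDeriv_unique {u g h : L2 Ω} (hg : HasWeakDeriv u g) (hh : HasWeakDeriv u h) :
    g = h := by
  have := (weakDerivGraph Ω).sub_mem (x := (u, g)) (y := (u, h)) hg hh
  rw [Prod.mk_sub_mk, sub_self] at this
  exact sub_eq_zero.1 (eq_zero_of_hasWeakDeriv_zero this)

theorem weakDerivTwo_spec (u : (weakDerivTwo Ω).domain) :
    ∃ g, HasWeakDeriv (u : L2 Ω) g ∧ HasWeakDeriv g (weakDerivTwo Ω u) := by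
  have h := (weakDerivTwo Ω).mem_graph u
  rwa [graph_weakDerivTwo] at h

theorem weakDerivTwo_eq {u : (weakDerivTwo Ω).domain} {g h : L2 Ω}
    (hg : HasWeakDeriv (u : L2 Ω) g) (hh : HasWeakDeriv g h) : weakDerivTwo Ω u = h := by
  obtain ⟨k, hk, hk'⟩ := weakDerivTwo_spec u
  obtain rfl := hasWeakDeriv_unique hk hg
  exact hasWeakDeriv_unique hk' hh

/-- The second weak derivative is dissipative on `H²(Ω) ∩ H¹₀(Ω)`. -/
theorem inner_weakDerivTwo_le_zero (u : (weakDerivTwo Ω).domain) (hu : (u : L2 Ω) ∈ H10 Ω) :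
    inner ℝ (weakDerivTwo Ω u) (u : L2 Ω) ≤ 0 := by
  obtain ⟨g, hg, hgc⟩ := mem_H10.1 hu
  obtain ⟨k, hk, hk'⟩ := weakDerivTwo_spec u
  obtain rfl := hasWeakDeriv_unique hk hg
  -- Testing u' against itself: ‖u'‖² = -⟨u'', u⟩.
  have h1 := inner_weakDeriv_eq_neg_inner hgc hk'
  have h2 : 0 ≤ inner ℝ k k := real_inner_self_nonneg
  linarith

/-- The weak solution `u ∈ H¹₀(Ω)` of `c u - u'' = f`, for `c > 0`. -/
theorem exists_weak_solution {c : ℝ} (hc : 0 < c) (f : L2 Ω) :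
    ∃ u g : L2 Ω, (u, g) ∈ closure (testGraph Ω : Set (L2 Ω × L2 Ω)) ∧
      HasWeakDeriv g (c • u - f) := by
  obtain ⟨r, hr, rfl⟩ : ∃ r : ℝ, 0 < r ∧ r ^ 2 = c := ⟨√c, Real.sqrt_pos.2 hc, Real.sq_sqrt hc.le⟩
  -- In the coordinates (r u, u') with r² = c the Hilbert norm squared is the energy c‖u‖² + ‖u'‖²,
  -- and `K` below is the image of H¹₀.
  let S : WithLp 2 (L2 Ω × L2 Ω) →L[ℝ] L2 Ω × L2 Ω :=
    ((r⁻¹ • ContinuousLinearMap.fst ℝ (L2 Ω) (L2 Ω)).prod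
      (ContinuousLinearMap.snd ℝ (L2 Ω) (L2 Ω))).comp
      (WithLp.prodContinuousLinearEquiv 2 ℝ (L2 Ω) (L2 Ω)).toContinuousLinearMap
  have hS (p : WithLp 2 (L2 Ω × L2 Ω)) : S p = (r⁻¹ • p.fst, p.snd) := rfl
  let K : Submodule ℝ (WithLp 2 (L2 Ω × L2 Ω)) :=
    (testGraph Ω).topologicalClosure.comap S.toLinearMap
  have hK : IsClosed (K : Set (WithLp 2 (L2 Ω × L2 Ω))) :=
    (testGraph Ω).isClosed_topologicalClosure.preimage S.continuous
  have : CompleteSpace K := hK.completeSpace_coe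
  -- Chosen so that ⟨v, (r φ, φ')⟩ = ⟨f, φ⟩; orthogonality of v - p to `K` is then the weak
  -- equation.
  let v : WithLp 2 (L2 Ω × L2 Ω) := WithLp.toLp 2 (r⁻¹ • f, 0)
  let p := K.starProjection v
  have hp : S p ∈ (testGraph Ω).topologicalClosure := K.starProjection_apply_mem v
  refine ⟨r⁻¹ • p.fst, p.snd, hp, hasWeakDeriv_iff_inner.2 fun φ => ?_⟩
  have hφ : WithLp.toLp 2 (r • testToL2 Ω φ, testDerivToL2 Ω φ) ∈ K := by
    refine (testGraph Ω).le_topologicalClosure ⟨φ, ?_⟩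
    change _ = (r⁻¹ • r • testToL2 Ω φ, testDerivToL2 Ω φ)
    rw [inv_smul_smul₀ hr.ne']
    rfl
  have h := K.starProjection_inner_eq_zero v _ hφ
  have h' : inner ℝ (r⁻¹ • f - p.fst) (r • testToL2 Ω φ)
      + inner ℝ (0 - p.snd) (testDerivToL2 Ω φ) = 0 := h
  simp only [inner_sub_left, real_inner_smul_left, real_inner_smul_right, inner_zero_left] at h' ⊢
  field_simp at h' ⊢
  linarith

/-- The operator `c - u''` maps `H²(Ω) ∩ H¹₀(Ω)` onto `L²(Ω)`. -/
theorem exists_smul_sub_weakDerivTwo_eq {c : ℝ} (hc : 0 < c) (f : L2 Ω) :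
    ∃ u : (weakDerivTwo Ω).domain, (u : L2 Ω) ∈ H10 Ω ∧ c • (u : L2 Ω) - weakDerivTwo Ω u = f := by
  obtain ⟨u, g, hug, hg⟩ := exists_weak_solution hc f
  have hu : HasWeakDeriv u g := closure_testGraph_subset hug
  refine ⟨⟨u, mem_H2.2 ⟨g, _, hu, hg⟩⟩, mem_H10.2 ⟨g, hu, hug⟩, ?_⟩
  -- The weak equation already exhibits u'' = c u - f in L²(Ω), so no regularity argument is needed.
  rw [weakDerivTwo_eq (u := ⟨u, mem_H2.2 ⟨g, _, hu, hg⟩⟩) hu hg, sub_sub_cancel]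

end Sobolev

/-! ### The operator on the product space, component by component -/

open Sobolev in
theorem diffusionOperator_dissipative {Ω : Opens ℝ} (V : (diffusionOperator Ω).domain) :
    inner ℝ (diffusionOperator Ω V) (V : EnergySpace Ω) ≤ 0 :=
  add_nonpos (inner_weakDerivTwo_le_zero ⟨V.1.fst, V.2.1.1⟩ V.2.1.2)
    (inner_weakDerivTwo_le_zero ⟨V.1.snd, V.2.2.1⟩ V.2.2.2)

open Sobolev in
theorem exists_smul_sub_diffusionOperator_eq {Ω : Opens ℝ} {c : ℝ} (hc : 0 < c)
    (F : EnergySpace Ω) :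
    ∃ V : (diffusionOperator Ω).domain, c • (V : EnergySpace Ω) - diffusionOperator Ω V = F := by
  obtain ⟨u, hu, hu'⟩ := exists_smul_sub_weakDerivTwo_eq hc F.fst
  obtain ⟨v, hv, hv'⟩ := exists_smul_sub_weakDerivTwo_eq hc F.snd
  exact ⟨⟨WithLp.toLp 2 (u, v), ⟨u.2, hu⟩, ⟨v.2, hv⟩⟩,
    congrArg (WithLp.toLp 2) (Prod.ext hu' hv')⟩

/-- For every bounded open set `Ω ⊆ ℝ`, the operator `A (u, v) = (u_xx, v_xx)` with domain
`(H²(Ω) ∩ H¹₀(Ω))²` is the infinitesimal generator of a `C₀`-semigroup of contractions on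
`L²(Ω) × L²(Ω)`. -/
theorem mainTheorem3 (Ω : Opens ℝ) (hΩ : Bornology.IsBounded (Ω : Set ℝ)) :
    ∃ T : C0Semigroup (EnergySpace Ω),
      T.IsContraction ∧ T.generator = diffusionOperator Ω := by
  exact exists_contraction_semigroup_generator_eq diffusionOperator_dissipative
    fun _ hc => exists_smul_sub_diffusionOperator_eq hc
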